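/- Let $K$ be a field, let $k\ge 1$ and $n\ge 2$ be integers, and let $S=K[x_1,\dots,x_n]$ with its standard $\mathbb{Z}^n$-grading. Let $P_n^k$ be the $k$-th power of the path on the vertices $1,\dots,n$, that is, the graph in which $i<j$ are adjacent if and only if $j-i\le k$, and let $I(P_n^k)=(x_ix_j : \{i,j\}\in E(P_n^k))\subset S$ be its edge ideal. A Stanley decomposition of a finitely generated $\mathbb{Z}^n$-graded $S$-module $M$ is a presentation of the $K$-vector space $M$ as a finite direct sum $M=\bigoplus_{i=1}^{s} v_iK[W_i]$, where each $v_i\in M$ is homogeneous, $W_i\subseteq\{x_1,\dots,x_n\}$, and $v_iK[W_i]$, the $K$-subspace generated by all $v_iw$ with $w$ a monomial in $K[W_i]$, is a free $K[W_i]$-module with basis $v_i$. The Stanley depth $\operatorname{sdepth}(M)$ is the maximum, over all Stanley decompositions of $M$, of $\min_i |W_i|$. The depth $\operatorname{depth}(M)$ is the maximal length of an $M$-regular sequence of elements of $(x_1,\dots,x_n)$. Then $$\operatorname{sdepth}\bigl(S/I(P_n^k)\bigr)=\left\lceil\frac{n}{2k+1}\right\rceil ,$$ and $\operatorname{sdepth}(S/I(P_n^k))=\operatorname{depth}(S/I(P_n^k))$.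 -/

import Mathlib

open MvPolynomial

noncomputable section

/-- The `k`-th power of the path on `n` vertices. The vertices `1, …, n` are represented by
`Fin n`, and distinct vertices are adjacent iff their distance `|i - j|` in the path is at
most `k`. -/
def pathPower (n k : ℕ) : SimpleGraph (Fin n) where
  Adj i j := (i < j ∧ (j : ℕ) - (i : ℕ) ≤ k) ∨ (j < i ∧ (i : ℕ) - (j : ℕ) ≤ k)
  symm := ⟨fun _ _ h => h.symm⟩
  loopless := ⟨fun i h => by rcases h with h | h <;> exact lt_irrefl i h.1⟩

/-- The edge ideal `I(G) = (x_i x_j : {i, j} ∈ E(G))` of `K[x_1, …, x_n]`. -/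
def edgeIdeal (K : Type*) [Field K] {n : ℕ} (G : SimpleGraph (Fin n)) :
    Ideal (MvPolynomial (Fin n) K) :=
  Ideal.span {f | ∃ i j, G.Adj i j ∧ f = X i * X j}

/-- The `ℤⁿ`-grading of `K[x_1, …, x_n] / I`: the component of degree `a` is the image of the
polynomials of multidegree `a`, where `x_i` has as its degree the `i`-th unit vector. (It is a
grading when `I` is a monomial ideal.) -/
def quotientGrading {K : Type*} [Field K] {n : ℕ} (I : Ideal (MvPolynomial (Fin n) K))
    (a : Fin n → ℤ) : Submodule K (MvPolynomial (Fin n) K ⧸ I) :=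
  (weightedHomogeneousSubmodule K (fun i : Fin n => (Pi.single i 1 : Fin n → ℤ)) a).map
    (Ideal.Quotient.mkₐ K I).toLinearMap

section Stanley

variable {K : Type*} [Field K] {n : ℕ} {M : Type*} [AddCommGroup M]
  [Module (MvPolynomial (Fin n) K) M] [Module K M]

/-- The `K`-subspace `v K[W]` of `M`, generated by all `w • v` with `w` a monomial in `K[W]`. -/
def stanleySpace (v : M) (W : Finset (Fin n)) : Submodule K M :=
  Submodule.span K
    {m | ∃ a : Fin n →₀ ℕ, a.support ⊆ W ∧ m = (monomial a (1 : K)) • v}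

/-- A Stanley decomposition of a `ℤⁿ`-graded `K[x_1, …, x_n]`-module `M` (with graded
components `ℳ a`): a presentation of the `K`-vector space `M` as a finite direct sum of
Stanley spaces `v_i K[W_i]`, each `v_i` being homogeneous, and each `v_i K[W_i]` being a free
`K[W_i]`-module with basis `v_i`. -/
structure StanleyDecomposition (ℳ : (Fin n → ℤ) → Submodule K M) where
  /-- the number of summands -/
  s : ℕ
  /-- the generators `v_i` -/
  v : Fin s → M
  /-- the sets of variables `W_i` -/
  W : Fin s → Finset (Fin n)
  homogeneous : ∀ i, ∃ a, v i ∈ ℳ a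
  free : ∀ i, ∀ f ∈ supported K (W i : Set (Fin n)), f • v i = 0 → f = 0
  isInternal : DirectSum.IsInternal (fun i => stanleySpace (K := K) (v i) (W i))

/-- The Stanley depth of a decomposition: the minimum of the `|W_i|`. -/
def StanleyDecomposition.sdepth {ℳ : (Fin n → ℤ) → Submodule K M}
    (D : StanleyDecomposition ℳ) : ℕ∞ :=
  ⨅ i, ((D.W i).card : ℕ∞)

/-- The Stanley depth of a `ℤⁿ`-graded module: the maximum of the Stanley depths of its Stanley
decompositions. -/
def stanleyDepth (ℳ : (Fin n → ℤ) → Submodule K M) : ℕ∞ :=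
  ⨆ D : StanleyDecomposition ℳ, D.sdepth

end Stanley

/-- The depth of a (graded) module over `S = K[x_1, …, x_n]`: the maximal length of an
`M`-regular sequence of elements of the graded maximal ideal `(x_1, …, x_n)`. -/
def gradedDepth (K : Type*) [Field K] (n : ℕ) (M : Type*) [AddCommGroup M]
    [Module (MvPolynomial (Fin n) K) M] : ℕ∞ :=
  ⨆ rs : {rs : List (MvPolynomial (Fin n) K) //
    (∀ r ∈ rs, r ∈ Ideal.span (Set.range (X : Fin n → MvPolynomial (Fin n) K))) ∧
      RingTheory.Sequence.IsRegular M rs}, (rs.1.length : ℕ∞)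

end

/-! Both invariants are squeezed between the same two graph numbers. If `s` vertices have pairwise
disjoint closed neighborhoods and `A` is a maximal independent set, then `s` ≤ depth, sdepth ≤
`|A|`. For the path power, explicit choices give the same number at both ends. Lower bounds: put J_Z
= I(G) + (x_i : i ∈ Z). For v ∉ Z, J_Z : x_v = J_{Z ∪ N(v)} and J_Z + (x_v) = J_{Z ∪ {v}}, so S/J_Z
is an extension of S/J_{Z ∪ {v}} by a shifted S/J_{Z ∪ N(v)}. A weakly regular sequence common to
both ends is weakly regular in the middle, and Stanley partitions of the ends combine.
`packing_induction` chooses v so that the process ends in polynomial rings that keep a variable from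
every closed neighborhood of the packing. Upper bounds: the squarefree monomial x_A has annihilator
(x_j : j ∉ A) in S/I(G). This associated prime bounds the depth through `length_le_coheight`, and a
Stanley space that reaches x_A can only use variables from A. -/

/-! ### Regular sequences, exact sequences and associated primes. -/

section CommutativeAlgebra

open RingTheory.Sequence Function
open scoped Pointwise

/-- A sequence that is weakly regular on both ends of a short exact sequence is weakly regular
on the middle term. -/
theorem isWeaklyRegular_of_exact {R : Type*} [CommRing R] (rs : List R) :
    ∀ {A B C : Type*} [AddCommGroup A] [Module R A] [AddCommGroup B] [Module R B]
      [AddCommGroup C] [Module R C] (f : A →ₗ[R] B) (g : B →ₗ[R] C),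
      Injective f → Exact f g → Surjective g →
      IsWeaklyRegular A rs → IsWeaklyRegular C rs → IsWeaklyRegular B rs := by
  induction rs with
  | nil => intros; exact IsWeaklyRegular.nil R _
  | cons r rs ih =>
    intro A B C _ _ _ _ _ _ f g hf hfg hg hA hC
    rw [isWeaklyRegular_cons_iff] at hA hC ⊢
    refine ⟨isSMulRegular_of_range_eq_ker hf hfg.linearMap_ker_eq.symm hA.1 hC.1, ?_⟩
    refine ih (QuotSMulTop.map r f) (QuotSMulTop.map r g) ?_ (QuotSMulTop.map_exact r hfg hg)
      (QuotSMulTop.map_surjective r hg) hA.2 hC.2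
    -- Injectivity of A/rA → B/rB uses that r is regular on C; this is the vanishing of Tor₁(C,
    -- R/r).
    have h0 : Exact (0 : A →ₗ[R] A) f := by
      intro x
      simp [map_eq_zero_iff f hf, eq_comm]
    have := QuotSMulTop.map_first_exact_on_four_term_exact_of_isSMulRegular_last h0 hfg hC.1
    rw [map_zero] at this
    rw [injective_iff_map_eq_zero]
    intro x hx
    obtain ⟨y, hy⟩ := (this x).1 hx
    simpa using hy.symm

/-- Passing from M to M/rM replaces p by a strictly larger associated prime. Let N be the submodule
killed by p. If N ⊆ rM, regularity of r gives N = rN, so N = 0 by Nakayama, which is absurd. An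
element y of N outside rM has a class whose annihilator contains p and r; an associated prime above
that annihilator contains r, whereas r ∉ p. -/
theorem length_le_coheight_of_isLocalRing {R : Type*} [CommRing R] [IsLocalRing R]
    [IsNoetherianRing R] (rs : List R) :
    ∀ {M : Type*} [AddCommGroup M] [Module R M] [Module.Finite R M] (p : PrimeSpectrum R),
      (∀ r ∈ rs, r ∈ IsLocalRing.maximalIdeal R) → IsWeaklyRegular M rs →
      IsAssociatedPrime p.asIdeal M → (rs.length : ℕ∞) ≤ Order.coheight p := by
  induction rs with
  | nil => intros; simp
  | cons r rs ih =>
    intro M _ _ _ p hrs hreg hp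
    rw [isWeaklyRegular_cons_iff] at hreg
    obtain ⟨-, u, hu⟩ := isAssociatedPrime_iff.1 hp
    have hmem : ∀ a, a ∈ p.asIdeal ↔ a • u = 0 := fun a => by
      rw [hu, Submodule.mem_colon_singleton, Submodule.mem_bot]
    have hu0 : u ≠ 0 := fun h => p.isPrime.ne_top <|
      (Ideal.eq_top_iff_one _).2 ((hmem 1).2 (by simp [h]))
    let N : Submodule R M := Submodule.torsionBySet R M p.asIdeal
    have hN : ∀ x, x ∈ N ↔ ∀ a ∈ p.asIdeal, a • x = 0 := fun x => by
      simp [N, Submodule.mem_torsionBySet_iff]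
    have huN : u ∈ N := (hN u).2 fun a ha => (hmem a).1 ha
    obtain ⟨y, hyN, hy⟩ : ∃ y ∈ N, y ∉ r • (⊤ : Submodule R M) := by
      by_contra! hcon
      have hle : N ≤ Ideal.span {r} • N := by
        intro x hx
        obtain ⟨z, -, rfl⟩ := (Submodule.mem_smul_pointwise_iff_exists _ _ _).1 (hcon x hx)
        refine Submodule.smul_mem_smul (Ideal.mem_span_singleton_self r) ((hN z).2 ?_)
        intro a ha
        refine hreg.1.right_eq_zero_of_smul ?_
        rw [smul_comm]
        exact (hN _).1 hx a ha
      have := Submodule.eq_bot_of_le_smul_of_le_jacobson_bot _ N (IsNoetherian.noetherian N) hle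
        (by
          rw [Ideal.span_singleton_le_iff_mem]
          exact IsLocalRing.maximalIdeal_le_jacobson _ (hrs r (by simp)))
      exact hu0 (by simpa [this] using huN)
    let y' : QuotSMulTop r M := Submodule.Quotient.mk y
    have hy' : y' ≠ 0 := fun h => hy ((Submodule.Quotient.mk_eq_zero _).1 h)
    obtain ⟨q, hq, hle⟩ := exists_le_isAssociatedPrime_of_isNoetherianRing R y' hy'
    have hkill : ∀ a, a • y ∈ r • (⊤ : Submodule R M) → a ∈ q := fun a ha => hle <| by
      rw [Submodule.mem_colon_singleton, Submodule.mem_bot]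
      exact (Submodule.Quotient.mk_eq_zero (r • (⊤ : Submodule R M)) (x := a • y)).2 ha
    have hpq : p.asIdeal ≤ q := fun a ha => hkill a <| by
      rw [(hN y).1 hyN a ha]
      exact zero_mem _
    have hrq : r ∈ q := hkill r (Submodule.smul_mem_pointwise_smul y r ⊤ trivial)
    have hrp : r ∉ p.asIdeal := fun h =>
      hu0 (hreg.1.right_eq_zero_of_smul ((hmem r).1 h))
    have hlt : p < ⟨q, hq.isPrime⟩ := lt_of_le_of_ne hpq fun h => hrp (by rw [h]; exact hrq)
    calc ((r :: rs).length : ℕ∞) = rs.length + 1 := by simp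
      _ ≤ Order.coheight (⟨q, hq.isPrime⟩ : PrimeSpectrum R) + 1 := by
        gcongr
        exact ih ⟨q, hq.isPrime⟩ (fun s hs => hrs s (by simp [hs])) hreg.2 hq
      _ ≤ Order.coheight p := Order.coheight_add_one_le hlt

/-- The length of a weakly regular sequence inside a prime `m` is at most the coheight of any
associated prime contained in `m`. -/
theorem length_le_coheight {R : Type*} [CommRing R] [IsNoetherianRing R] {M : Type*}
    [AddCommGroup M] [Module R M] [Module.Finite R M] (m : Ideal R) [m.IsPrime] (rs : List R)
    (hrs : ∀ r ∈ rs, r ∈ m) (hreg : IsWeaklyRegular M rs) (p : PrimeSpectrum R)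
    (hp : IsAssociatedPrime p.asIdeal M) (hpm : p.asIdeal ≤ m) :
    (rs.length : ℕ∞) ≤ Order.coheight p := by
  -- Localizing at m makes Nakayama available; contraction of primes is strictly monotone, so the
  -- coheight does not drop on returning to R.
  let R' := Localization.AtPrime m
  let M' := LocalizedModule.AtPrime m M
  have hdisj : Disjoint (m.primeCompl : Set R) (p.asIdeal : Set R) :=
    Set.disjoint_left.2 fun a ha hap => ha (hpm hap)
  have hpr : (p.asIdeal.map (algebraMap R R')).IsPrime :=
    IsLocalization.isPrime_of_isPrime_disjoint m.primeCompl R' _ p.isPrime hdisj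
  have hcomap : (p.asIdeal.map (algebraMap R R')).comap (algebraMap R R') = p.asIdeal :=
    IsLocalization.under_map_of_isPrime_disjoint m.primeCompl R' p.isPrime hdisj
  let p' : PrimeSpectrum R' := ⟨_, hpr⟩
  have hass : IsAssociatedPrime p'.asIdeal M' :=
    Module.associatedPrimes.mem_associatedPrimes_of_comap_mem_associatedPrimes_of_isLocalizedModule
      m.primeCompl (LocalizedModule.mkLinearMap m.primeCompl M) p'.asIdeal
      (by rw [hcomap]; exact hp)
  have h1 := length_le_coheight_of_isLocalRing (rs.map (algebraMap R R')) (M := M') p' (by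
      intro r hr
      obtain ⟨s, hs, rfl⟩ := List.mem_map.1 hr
      exact (IsLocalization.AtPrime.to_map_mem_maximal_iff R' m s).2 (hrs s hs))
    (hreg.of_isLocalizedModule R' m.primeCompl (LocalizedModule.mkLinearMap m.primeCompl M)) hass
  rw [List.length_map] at h1
  refine h1.trans ?_
  have hmono : StrictMono (PrimeSpectrum.comap (algebraMap R R')) := by
    intro a b hab
    refine lt_of_le_of_ne (Ideal.comap_mono hab.le) fun h => hab.ne ?_
    exact PrimeSpectrum.localization_comap_injective R' m.primeCompl h
  have h2 := Order.coheight_le_coheight_apply_of_strictMono _ hmono p'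
  rwa [show PrimeSpectrum.comap (algebraMap R R') p' = p from PrimeSpectrum.ext hcomap] at h2

end CommutativeAlgebra

/-! ### Induction on deleted vertex sets. -/

section Packing

variable {V : Type*} (G : SimpleGraph V)

/-- The closed neighborhood of a vertex. -/
def closedNbhd (v : V) : Set V := insert v (G.neighborSet v)

/-- Induction on deleted vertex sets: if the closed neighborhoods of `c` are pairwise disjoint, one
reaches every case from the edgeless graphs meeting all these neighborhoods by splitting off a
vertex, which is either deleted itself or has its neighbors deleted. -/
theorem packing_induction [Finite V] {ι : Type*} {c : ι → V}
    (hc : Pairwise fun s t => Disjoint (closedNbhd G (c s)) (closedNbhd G (c t)))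
    (Q : Set V → Prop)
    (base : ∀ Z : Set V, (∀ i j, G.Adj i j → i ∈ Z ∨ j ∈ Z) →
      (∀ t, ∃ w ∈ closedNbhd G (c t), w ∉ Z) → Q Z)
    (step : ∀ (Z : Set V) (v : V), v ∉ Z → Q (insert v Z) → Q (Z ∪ G.neighborSet v) → Q Z) :
    Q ∅ := by
  -- Invariant: each closed neighborhood keeps its center, or else a surviving vertex that has
  -- become isolated and so will never be deleted.
  suffices H : ∀ (N : ℕ) (Z : Set V), Zᶜ.ncard = N →
      (∀ t, c t ∉ Z ∨ ∃ w ∈ closedNbhd G (c t), w ∉ Z ∧ ∀ j, G.Adj w j → j ∈ Z) → Q Z from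
    H _ ∅ rfl fun t => Or.inl (Set.notMem_empty _)
  intro N
  induction N using Nat.strong_induction_on with
  | _ N ih =>
    intro Z hN hZ
    have hlt : ∀ (Z' : Set V) (x : V), Z ⊆ Z' → x ∈ Z' → x ∉ Z → Z'ᶜ.ncard < N := by
      intro Z' x hsub hx hx'
      rw [← hN]
      refine Set.ncard_lt_ncard ?_ (Set.toFinite _)
      exact compl_lt_compl_iff_lt.2 ⟨hsub, fun h => hx' (h hx)⟩
    by_cases hE : ∀ i j, G.Adj i j → i ∈ Z ∨ j ∈ Z
    · refine base Z hE fun t => ?_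
      rcases hZ t with h | ⟨w, hw, hwZ, -⟩
      · exact ⟨c t, Set.mem_insert _ _, h⟩
      · exact ⟨w, hw, hwZ⟩
    -- Disjointness forbids an edge between two centers, so a surviving edge has an end v that is
    -- not a center. Deleting v keeps all centers; deleting N(v) may remove a center, but then v
    -- itself is its isolated replacement.
    · obtain ⟨v, w, hvw, hv, hw, hvc⟩ :
          ∃ v w, G.Adj v w ∧ v ∉ Z ∧ w ∉ Z ∧ ∀ t, c t ≠ v := by
        push Not at hE
        obtain ⟨i, j, hij, hi, hj⟩ := hE
        by_cases h : ∀ t, c t ≠ i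
        · exact ⟨i, j, hij, hi, hj, h⟩
        · push Not at h
          obtain ⟨s, rfl⟩ := h
          refine ⟨j, c s, hij.symm, hj, hi, ?_⟩
          rintro t rfl
          have hst : s ≠ t := fun h => hij.ne (by rw [h])
          exact Set.disjoint_left.1 (hc hst) (Set.mem_insert_of_mem _ hij) (Set.mem_insert _ _)
      refine step Z v hv ?_ ?_
      · refine ih _ (hlt _ v (Set.subset_insert _ _) (Set.mem_insert _ _) hv) _ rfl fun t => ?_
        rcases hZ t with h | ⟨x, hx, hxZ, hxN⟩
        · left
          simp [hvc t, h]
        · refine Or.inr ⟨x, hx, ?_, fun j hj => Set.mem_insert_of_mem _ (hxN j hj)⟩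
          rintro (rfl | h)
          · exact hw (hxN w hvw)
          · exact hxZ h
      · refine ih _ (hlt _ w Set.subset_union_left (Or.inr hvw) hw) _ rfl fun t => ?_
        rcases hZ t with h | ⟨x, hx, hxZ, hxN⟩
        · by_cases hadj : G.Adj v (c t)
          · refine Or.inr ⟨v, Set.mem_insert_of_mem _ hadj.symm, ?_, fun j hj => Or.inr hj⟩
            rintro (h' | h')
            · exact hv h'
            · exact G.loopless.irrefl v h'
          · left
            rintro (h' | h')
            · exact h h'
            · exact hadj h'
        · refine Or.inr ⟨x, hx, ?_, fun j hj => Or.inl (hxN j hj)⟩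
          rintro (h' | h')
          · exact hxZ h'
          · exact hv (hxN v (G.adj_symm h'))

end Packing

/-! ### Monomial description of the ideals and their colons. -/

section DeletionIdeal

variable {n : ℕ} (G : SimpleGraph (Fin n)) (Z : Set (Fin n))

/-- The exponents of the monomials outside `I(G) + (x_i : i ∈ Z)`. -/
def IsStandardExponent (a : Fin n →₀ ℕ) : Prop :=
  (∀ i j, G.Adj i j → a i = 0 ∨ a j = 0) ∧ ∀ i ∈ Z, a i = 0

/-- The ideal `I(G) + (x_i : i ∈ Z)`. -/
noncomputable def deletionIdeal (K : Type*) [Field K] : Ideal (MvPolynomial (Fin n) K) :=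
  edgeIdeal K G ⊔ Ideal.span (X '' Z)

variable {G Z}

theorem single_one_le_iff {i : Fin n} {a : Fin n →₀ ℕ} : Finsupp.single i 1 ≤ a ↔ a i ≠ 0 := by
  rw [Finsupp.single_le_iff, Nat.one_le_iff_ne_zero]

theorem single_add_single_le_iff {i j : Fin n} (hij : i ≠ j) {a : Fin n →₀ ℕ} :
    Finsupp.single i 1 + Finsupp.single j 1 ≤ a ↔ a i ≠ 0 ∧ a j ≠ 0 := by
  constructor
  · intro h
    exact ⟨single_one_le_iff.1 (le_self_add.trans h), single_one_le_iff.1 (le_add_self.trans h)⟩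
  · rintro ⟨hi, hj⟩ l
    simp only [Finsupp.add_apply, Finsupp.single_apply]
    split_ifs with h1 h2 h2
    · exact absurd (h1.trans h2.symm) hij
    · subst h1; omega
    · subst h2; omega
    · omega

theorem mem_deletionIdeal {K : Type*} [Field K] {f : MvPolynomial (Fin n) K} :
    f ∈ deletionIdeal G Z K ↔ ∀ a ∈ f.support, ¬ IsStandardExponent G Z a := by
  have hspan : deletionIdeal G Z K = Ideal.span ((fun s => monomial s (1 : K)) ''
      ({s | ∃ i j, G.Adj i j ∧ s = Finsupp.single i 1 + Finsupp.single j 1} ∪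
        {s | ∃ i ∈ Z, s = Finsupp.single i 1})) := by
    rw [deletionIdeal, edgeIdeal, Set.image_union, Ideal.span_union]
    congr 2
    · ext f
      constructor
      · rintro ⟨i, j, hij, rfl⟩
        exact ⟨_, ⟨i, j, hij, rfl⟩, by simp [X, monomial_mul]⟩
      · rintro ⟨_, ⟨i, j, hij, rfl⟩, rfl⟩
        exact ⟨i, j, hij, by simp [X, monomial_mul]⟩
    · ext f
      constructor
      · rintro ⟨i, hi, rfl⟩
        exact ⟨_, ⟨i, hi, rfl⟩, rfl⟩
      · rintro ⟨_, ⟨i, hi, rfl⟩, rfl⟩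
        exact ⟨i, hi, rfl⟩
  rw [hspan, mem_ideal_span_monomial_image]
  refine forall₂_congr fun a _ => ?_
  constructor
  · rintro ⟨s, ⟨i, j, hij, rfl⟩ | ⟨i, hi, rfl⟩, hle⟩ ⟨h1, h2⟩
    · obtain ⟨hi, hj⟩ := (single_add_single_le_iff hij.ne).1 hle
      exact (h1 i j hij).elim hi hj
    · exact single_one_le_iff.1 hle (h2 i hi)
  · intro h
    rw [IsStandardExponent, not_and_or] at h
    push Not at h
    rcases h with ⟨i, j, hij, hi, hj⟩ | ⟨i, hi, hi'⟩
    · exact ⟨_, Or.inl ⟨i, j, hij, rfl⟩, (single_add_single_le_iff hij.ne).2 ⟨hi, hj⟩⟩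
    · exact ⟨_, Or.inr ⟨i, hi, rfl⟩, single_one_le_iff.2 hi'⟩

theorem deletionIdeal_empty (K : Type*) [Field K] : deletionIdeal G ∅ K = edgeIdeal K G := by
  simp [deletionIdeal]

theorem deletionIdeal_eq_span (K : Type*) [Field K] (hZ : ∀ i j, G.Adj i j → i ∈ Z ∨ j ∈ Z) :
    deletionIdeal G Z K = Ideal.span (X '' Z) := by
  refine le_antisymm (sup_le (Ideal.span_le.2 ?_) le_rfl) le_sup_right
  rintro _ ⟨i, j, hij, rfl⟩
  rcases hZ i j hij with h | h
  · exact Ideal.mul_mem_right _ _ (Ideal.subset_span ⟨i, h, rfl⟩)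
  · exact Ideal.mul_mem_left _ _ (Ideal.subset_span ⟨j, h, rfl⟩)

theorem deletionIdeal_insert (K : Type*) [Field K] (v : Fin n) :
    deletionIdeal G (insert v Z) K = deletionIdeal G Z K ⊔ Ideal.span {X v} := by
  rw [deletionIdeal, deletionIdeal, Set.image_insert_eq, Ideal.span_insert, sup_assoc,
    sup_comm (Ideal.span {X v})]

/-- The colon identity J_Z : x_v = J_{Z ∪ N(v)} at the level of exponents, used for both depth and
Stanley depth. -/
theorem isStandardExponent_add_single {v : Fin n} (hv : v ∉ Z) {a : Fin n →₀ ℕ} :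
    IsStandardExponent G Z (a + Finsupp.single v 1) ↔
      IsStandardExponent G (Z ∪ G.neighborSet v) a := by
  have happ : ∀ i, i ≠ v → (a + Finsupp.single v 1 : Fin n →₀ ℕ) i = a i := fun i hi => by
    simp [hi.symm]
  have hpos : (a + Finsupp.single v 1 : Fin n →₀ ℕ) v ≠ 0 := by simp
  constructor
  · rintro ⟨h1, h2⟩
    refine ⟨fun i j hij => ?_, ?_⟩
    · have := h1 i j hij
      simp only [Finsupp.add_apply, Nat.add_eq_zero_iff] at this
      exact this.imp And.left And.left
    · rintro i (hi | hi)
      · have := h2 i hi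
        simp only [Finsupp.add_apply, Nat.add_eq_zero_iff] at this
        exact this.1
      · rw [← happ i (G.ne_of_adj hi).symm]
        exact (h1 v i hi).resolve_left hpos
  · rintro ⟨h1, h2⟩
    refine ⟨fun i j hij => ?_, fun i hi => ?_⟩
    · by_cases hiv : i = v
      · subst hiv
        right
        rw [happ j hij.ne.symm]
        exact h2 j (Or.inr hij)
      · by_cases hjv : j = v
        · subst hjv
          left
          rw [happ i hiv]
          exact h2 i (Or.inr hij.symm)
        · rw [happ i hiv, happ j hjv]
          exact h1 i j hij
    · rw [happ i (fun h => hv (h ▸ hi))]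
      exact h2 i (Or.inl hi)

theorem X_mul_mem_deletionIdeal {K : Type*} [Field K] {v : Fin n} (hv : v ∉ Z)
    (f : MvPolynomial (Fin n) K) :
    X v * f ∈ deletionIdeal G Z K ↔ f ∈ deletionIdeal G (Z ∪ G.neighborSet v) K := by
  rw [mul_comm, mem_deletionIdeal, mem_deletionIdeal, support_mul_X]
  simp only [Finset.mem_map, addRightEmbedding_apply, forall_exists_index, and_imp,
    forall_apply_eq_imp_iff₂, isStandardExponent_add_single hv]

end DeletionIdeal

/-! ### Lower bound for the depth. -/

section DepthLowerBound

open RingTheory.Sequence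

/-- Uses 0 → R/(J : x) → R/J → R/(J + (x)) → 0, whose first map is multiplication by x. -/
theorem isWeaklyRegular_quotient_of_colon {R : Type*} [CommRing R] {J J' J'' : Ideal R} {x : R}
    (h' : ∀ f, x * f ∈ J ↔ f ∈ J') (h'' : J'' = J ⊔ Ideal.span {x}) {rs : List R}
    (hreg' : IsWeaklyRegular (R ⧸ J') rs) (hreg'' : IsWeaklyRegular (R ⧸ J'') rs) :
    IsWeaklyRegular (R ⧸ J) rs := by
  subst h''
  let φ : (R ⧸ J') →ₗ[R] R ⧸ J := Submodule.mapQ J' J (LinearMap.mulLeft R x) fun f => (h' f).2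
  let ψ : (R ⧸ J) →ₗ[R] R ⧸ J ⊔ Ideal.span {x} := Submodule.factor le_sup_left
  have hφ : ∀ f, φ (Ideal.Quotient.mk J' f) = Ideal.Quotient.mk J (x * f) := fun _ => rfl
  have hψ : ∀ f, ψ (Ideal.Quotient.mk J f) = Ideal.Quotient.mk _ f := fun _ => rfl
  refine isWeaklyRegular_of_exact rs φ ψ ?_ ?_ (Submodule.factor_surjective _) hreg' hreg''
  · rw [injective_iff_map_eq_zero]
    intro y hy
    obtain ⟨f, rfl⟩ := Ideal.Quotient.mk_surjective y
    rw [hφ, Ideal.Quotient.eq_zero_iff_mem] at hy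
    exact Ideal.Quotient.eq_zero_iff_mem.2 ((h' f).1 hy)
  · intro y
    obtain ⟨f, rfl⟩ := Ideal.Quotient.mk_surjective y
    rw [hψ, Ideal.Quotient.eq_zero_iff_mem]
    constructor
    · intro hf
      obtain ⟨j, hj, z, hz, rfl⟩ := Submodule.mem_sup.1 hf
      obtain ⟨g, rfl⟩ := Ideal.mem_span_singleton'.1 hz
      refine ⟨Ideal.Quotient.mk J' g, ?_⟩
      rw [hφ, Ideal.Quotient.eq, show x * g - (j + g * x) = -j by ring]
      exact J.neg_mem hj
    · rintro ⟨z, hz⟩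
      obtain ⟨g, rfl⟩ := Ideal.Quotient.mk_surjective z
      rw [hφ, eq_comm, Ideal.Quotient.eq] at hz
      rw [← sub_add_cancel f (x * g)]
      exact Ideal.add_mem _ (Ideal.mem_sup_left hz) (Ideal.mem_sup_right
        (Ideal.mul_mem_right _ _ (Ideal.mem_span_singleton_self x)))

theorem isWeaklyRegular_quotient_of_forall {R : Type*} [CommRing R] {J : Ideal R} {rs : List R}
    (h : ∀ (i : ℕ) (hi : i < rs.length) (f : R), rs[i] * f ∈ J ⊔ Ideal.ofList (rs.take i) →
      f ∈ J ⊔ Ideal.ofList (rs.take i)) : IsWeaklyRegular (R ⧸ J) rs := by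
  have hmem : ∀ (I : Ideal R) (f : R),
      Ideal.Quotient.mk J f ∈ (I • ⊤ : Submodule R (R ⧸ J)) ↔ f ∈ J ⊔ I := by
    intro I f
    rw [Ideal.smul_top_eq_map, Submodule.restrictScalars_mem, Ideal.Quotient.algebraMap_eq,
      Ideal.mem_quotient_iff_mem_sup, sup_comm]
  refine ⟨fun i hi => ?_⟩
  rw [isSMulRegular_quotient_iff_mem_of_smul_mem]
  intro y hy
  obtain ⟨f, rfl⟩ := Ideal.Quotient.mk_surjective y
  exact (hmem _ _).2 (h i hi f ((hmem _ _).1 hy))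

/-- Sums of variables over disjoint sets not contained in `Z` form a regular sequence modulo
`(x_i : i ∈ Z)`. -/
theorem isWeaklyRegular_sum_X {K : Type*} [Field K] {n s : ℕ} {Z : Set (Fin n)}
    {J : Ideal (MvPolynomial (Fin n) K)} (hJ : J = Ideal.span (X '' Z))
    {B : Fin s → Finset (Fin n)} (hB : Pairwise fun t u => Disjoint (B t) (B u))
    {w : Fin s → Fin n} (hwB : ∀ t, w t ∈ B t) (hwZ : ∀ t, w t ∉ Z) :
    IsWeaklyRegular (MvPolynomial (Fin n) K ⧸ J)
      (List.ofFn fun t => ∑ i ∈ B t, (X i : MvPolynomial (Fin n) K)) := by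
  classical
  refine isWeaklyRegular_quotient_of_forall fun i hi f hf => ?_
  set I := J ⊔ Ideal.ofList ((List.ofFn fun t => ∑ i ∈ B t,
    (X i : MvPolynomial (Fin n) K)).take i) with hI
  have his : i < s := by simpa using hi
  rw [List.getElem_ofFn] at hf
  have hwB' : ∀ t u, w t ∈ B u ↔ t = u := fun t u => by
    refine ⟨fun h => ?_, fun h => h ▸ hwB t⟩
    by_contra hne
    exact Finset.disjoint_left.1 (hB hne) (hwB t) h
  have hXI : ∀ l ∈ Z, (X l : MvPolynomial (Fin n) K) ∈ I := fun l hl =>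
    Ideal.mem_sup_left (hJ ▸ Ideal.subset_span ⟨l, hl, rfl⟩)
  have hθI : ∀ t : Fin s, (t : ℕ) < i → (∑ l ∈ B t, X l : MvPolynomial (Fin n) K) ∈ I := by
    intro t ht
    refine Ideal.mem_sup_right (Ideal.subset_span ?_)
    exact List.mem_take_iff_getElem.2 ⟨t, by simp [ht], by simp⟩
  let ρ : Fin n → MvPolynomial (Fin n) K := fun l => if l ∈ Z then 0 else X l
  have hρ : ∀ l, X l - ρ l ∈ I := fun l => by
    by_cases hl : l ∈ Z
    · simpa [ρ, hl] using hXI l hl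
    · simp [ρ, hl]
  let τ : Fin s → MvPolynomial (Fin n) K := fun t => ∑ l ∈ B t, ρ l
  have hτ : ∀ t : Fin s, (t : ℕ) < i → τ t ∈ I := fun t ht => by
    have : τ t = ∑ l ∈ B t, X l - ∑ l ∈ B t, (X l - ρ l) := by
      rw [Finset.sum_sub_distrib, sub_sub_cancel]
    rw [this]
    exact I.sub_mem (hθI t ht) (I.sum_mem fun l _ => hρ l)
  -- Elimination: φ kills the variables of Z and uses x_{w t} to solve the t-th linear form for t <
  -- i. It kills I and is the identity modulo I, so its kernel is I and S/I embeds in a domain; it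
  -- remains to see that the i-th form survives.
  let φ : MvPolynomial (Fin n) K →ₐ[K] MvPolynomial (Fin n) K :=
    aeval fun l => ρ l - ∑ t : Fin s, if (t : ℕ) < i ∧ w t = l then τ t else 0
  have hφX : ∀ l, φ (X l) = ρ l - ∑ t : Fin s, if (t : ℕ) < i ∧ w t = l then τ t else 0 :=
    fun l => aeval_X _ l
  have hφθ : ∀ u : Fin s, φ (∑ l ∈ B u, X l) = τ u - if (u : ℕ) < i then τ u else 0 := by
    intro u
    rw [map_sum]
    simp only [hφX]
    rw [Finset.sum_sub_distrib, Finset.sum_comm]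
    congr 1
    rw [Finset.sum_eq_single u]
    · by_cases hu : (u : ℕ) < i
      · simp [hu, hwB u]
      · simp [hu]
    · intro t _ htu
      refine Finset.sum_eq_zero fun l hl => ?_
      rw [if_neg]
      rintro ⟨-, rfl⟩
      exact htu ((hwB' t u).1 hl)
    · simp
  have hker : ∀ g ∈ I, φ g = 0 := by
    have : I ≤ RingHom.ker φ := by
      rw [hI]
      refine sup_le ?_ (Ideal.span_le.2 ?_)
      · rw [hJ, Ideal.span_le]
        rintro _ ⟨l, hl, rfl⟩
        rw [SetLike.mem_coe, RingHom.mem_ker, hφX, Finset.sum_eq_zero]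
        · simp [ρ, hl]
        · intro t _
          rw [if_neg]
          rintro ⟨-, rfl⟩
          exact hwZ t hl
      · intro g hg
        obtain ⟨t, ht, rfl⟩ := List.mem_take_iff_getElem.1 hg
        rw [SetLike.mem_coe, RingHom.mem_ker, List.getElem_ofFn, hφθ]
        simp [(lt_min_iff.1 ht).1]
    exact fun g hg => this hg
  have hretract : ∀ g, g - φ g ∈ I := by
    have : (Ideal.Quotient.mkₐ K I).comp φ = Ideal.Quotient.mkₐ K I := by
      refine algHom_ext fun l => ?_
      rw [AlgHom.comp_apply, Ideal.Quotient.mkₐ_eq_mk, eq_comm, Ideal.Quotient.eq, hφX,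
        ← sub_add]
      refine I.add_mem (hρ l) (I.sum_mem fun t _ => ?_)
      split_ifs with h
      · exact hτ t h.1
      · exact I.zero_mem
    intro g
    rw [← Ideal.Quotient.eq]
    exact (DFunLike.congr_fun this g).symm
  have h0 : φ (∑ l ∈ B ⟨i, his⟩, X l) * φ f = 0 := by
    rw [← map_mul]
    exact hker _ hf
  have hne : φ (∑ l ∈ B ⟨i, his⟩, X l) ≠ 0 := by
    rw [hφθ]
    simp only [lt_irrefl, if_false, sub_zero]
    intro h
    -- At the unit vector of `w i` the i-th form takes the value 1.
    have hev := congrArg (aeval (R := K) (fun l => if l = w ⟨i, his⟩ then (1 : K) else 0)) h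
    rw [map_sum, map_zero, Finset.sum_eq_single (w ⟨i, his⟩)] at hev
    · simp [ρ, hwZ] at hev
    · intro l _ hl
      by_cases hlZ : l ∈ Z <;> simp [ρ, hlZ, hl]
    · exact fun h => absurd (hwB _) h
  have := hretract f
  rwa [(mul_eq_zero.1 h0).resolve_left hne, sub_zero] at this

/-- The depth of `S/I(G)` is at least the number of vertices with pairwise disjoint closed
neighborhoods. -/
theorem le_gradedDepth_of_packing (K : Type*) [Field K] {n s : ℕ} (G : SimpleGraph (Fin n))
    {c : Fin s → Fin n}
    (hc : Pairwise fun t u => Disjoint (closedNbhd G (c t)) (closedNbhd G (c u))) :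
    (s : ℕ∞) ≤ gradedDepth K n (MvPolynomial (Fin n) K ⧸ edgeIdeal K G) := by
  classical
  let B : Fin s → Finset (Fin n) := fun t => (closedNbhd G (c t)).toFinset
  have hB : Pairwise fun t u => Disjoint (B t) (B u) := fun t u htu => by
    simpa [B, Set.disjoint_toFinset] using hc htu
  let rs := List.ofFn fun t => ∑ i ∈ B t, (X i : MvPolynomial (Fin n) K)
  have hreg : IsWeaklyRegular (MvPolynomial (Fin n) K ⧸ edgeIdeal K G) rs := by
    rw [← deletionIdeal_empty]
    refine packing_induction G hc
      (fun Z => IsWeaklyRegular (MvPolynomial (Fin n) K ⧸ deletionIdeal G Z K) rs) ?_ ?_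
    · intro Z hZ hw
      choose w hw hwZ using hw
      exact isWeaklyRegular_sum_X (deletionIdeal_eq_span K hZ) hB (w := w)
        (fun t => by simpa [B] using hw t) hwZ
    · intro Z v hv h1 h2
      exact isWeaklyRegular_quotient_of_colon (X_mul_mem_deletionIdeal hv)
        (deletionIdeal_insert K v) h2 h1
  let m : Ideal (MvPolynomial (Fin n) K) := Ideal.span (Set.range X)
  have hXm : ∀ i, (X i : MvPolynomial (Fin n) K) ∈ m := fun i => Ideal.subset_span ⟨i, rfl⟩
  have hrs : ∀ r ∈ rs, r ∈ m := by
    intro r hr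
    obtain ⟨t, rfl⟩ := List.mem_ofFn.1 hr
    exact m.sum_mem fun i _ => hXm i
  have hm : m ≠ ⊤ := by
    intro h
    have hle : m ≤ RingHom.ker (constantCoeff (σ := Fin n) (R := K)) :=
      Ideal.span_le.2 (by rintro _ ⟨i, rfl⟩; simp)
    rw [h, top_le_iff] at hle
    exact RingHom.ker_ne_top _ hle
  have hIm : edgeIdeal K G ≤ m := Ideal.span_le.2 <| by
    rintro _ ⟨i, j, -, rfl⟩
    exact Ideal.mul_mem_right _ _ (hXm i)
  have htop : (⊤ : Submodule (MvPolynomial (Fin n) K) (MvPolynomial (Fin n) K ⧸ edgeIdeal K G)) ≠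
      Ideal.ofList rs • ⊤ := by
    intro h
    have h1 : (Ideal.Quotient.mk (edgeIdeal K G) 1) ∈ (Ideal.ofList rs • ⊤ :
        Submodule (MvPolynomial (Fin n) K) (MvPolynomial (Fin n) K ⧸ edgeIdeal K G)) := h ▸ trivial
    rw [Ideal.smul_top_eq_map, Submodule.restrictScalars_mem, Ideal.Quotient.algebraMap_eq,
      Ideal.mem_quotient_iff_mem_sup] at h1
    exact hm ((Ideal.eq_top_iff_one _).2 (sup_le (Ideal.span_le.2 hrs) hIm h1))
  have hlen : rs.length = s := List.length_ofFn
  rw [← hlen]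
  exact le_iSup (fun rs : {rs : List (MvPolynomial (Fin n) K) //
    (∀ r ∈ rs, r ∈ Ideal.span (Set.range (X : Fin n → MvPolynomial (Fin n) K))) ∧
      IsRegular (MvPolynomial (Fin n) K ⧸ edgeIdeal K G) rs} => (rs.1.length : ℕ∞))
    ⟨rs, hrs, ⟨hreg, htop⟩⟩

end DepthLowerBound

/-! ### Upper bound for the depth. -/

section DepthUpperBound

open RingTheory.Sequence

variable {n : ℕ} {G : SimpleGraph (Fin n)} {A : Finset (Fin n)}

theorem isPrime_span_image_X {σ K : Type*} [Field K] (Z : Set σ) :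
    (Ideal.span ((X : σ → MvPolynomial σ K) '' Z)).IsPrime := by
  classical
  set I := Ideal.span ((X : σ → MvPolynomial σ K) '' Z)
  let φ : MvPolynomial σ K →ₐ[K] MvPolynomial σ K := aeval fun i => if i ∈ Z then 0 else X i
  have hretract : (Ideal.Quotient.mkₐ K I).comp φ = Ideal.Quotient.mkₐ K I := by
    refine algHom_ext fun i => ?_
    rw [AlgHom.comp_apply, aeval_X]
    split_ifs with hi
    · rw [map_zero, eq_comm, Ideal.Quotient.mkₐ_eq_mk, Ideal.Quotient.eq_zero_iff_mem]
      exact Ideal.subset_span ⟨i, hi, rfl⟩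
    · rfl
  have hker : I = RingHom.ker φ := by
    refine le_antisymm (Ideal.span_le.2 ?_) fun f hf => ?_
    · rintro _ ⟨i, hi, rfl⟩
      simp [φ, hi]
    · have := DFunLike.congr_fun hretract f
      rw [AlgHom.comp_apply, (RingHom.mem_ker).1 hf, map_zero, eq_comm, Ideal.Quotient.mkₐ_eq_mk,
        Ideal.Quotient.eq_zero_iff_mem] at this
      exact this
  rw [hker]
  exact RingHom.ker_isPrime _

/-- Take colons by one variable at a time; independence ensures that the next variable has not been
deleted yet. -/
theorem prod_X_mul_mem_edgeIdeal {K : Type*} [Field K]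
    (hind : ∀ i ∈ A, ∀ j ∈ A, ¬ G.Adj i j) (f : MvPolynomial (Fin n) K) :
    (∏ i ∈ A, X i) * f ∈ edgeIdeal K G ↔
      f ∈ deletionIdeal G {j | ∃ i ∈ A, G.Adj i j} K := by
  classical
  rw [← deletionIdeal_empty]
  induction A using Finset.induction_on generalizing f with
  | empty => simp
  | insert a T ha ih =>
    rw [Finset.prod_insert ha, mul_comm (X a), mul_assoc,
      ih (fun i hi j hj => hind i (by simp [hi]) j (by simp [hj])), X_mul_mem_deletionIdeal]
    · have : {j | ∃ i ∈ T, G.Adj i j} ∪ G.neighborSet a =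
          {j | ∃ i ∈ insert a T, G.Adj i j} := by
        ext j
        simp [or_comm]
      rw [this]
    · rintro ⟨i, hi, hia⟩
      exact hind i (by simp [hi]) a (by simp) hia

/-- The coheight of p is dim S/p, and S/p is a quotient of the polynomial ring in the variables of
A. -/
theorem coheight_span_X_compl_le (K : Type*) [Field K] (p : PrimeSpectrum (MvPolynomial (Fin n) K))
    (hp : p.asIdeal = Ideal.span (X '' (A : Set (Fin n))ᶜ)) :
    Order.coheight p ≤ A.card := by
  let φ : MvPolynomial A K →ₐ[K] MvPolynomial (Fin n) K ⧸ p.asIdeal :=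
    (Ideal.Quotient.mkₐ K p.asIdeal).comp (rename Subtype.val)
  have hφ : Function.Surjective φ := by
    rw [← AlgHom.range_eq_top, eq_top_iff]
    rintro y -
    obtain ⟨f, rfl⟩ := Ideal.Quotient.mk_surjective y
    induction f using MvPolynomial.induction_on with
    | C a => exact φ.range.algebraMap_mem a
    | add f g hf hg => rw [map_add]; exact add_mem hf hg
    | mul_X f i hf =>
      rw [map_mul]
      refine mul_mem hf ?_
      by_cases hi : i ∈ A
      · exact ⟨X ⟨i, hi⟩, by simp [φ]⟩
      · rw [Ideal.Quotient.eq_zero_iff_mem.2 (hp ▸ Ideal.subset_span ⟨i, hi, rfl⟩)]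
        exact zero_mem _
  have h1 := ringKrullDim_le_of_surjective φ.toRingHom hφ
  rw [MvPolynomial.ringKrullDim_of_isNoetherianRing, ringKrullDim_eq_zero_of_field, zero_add,
    ringKrullDim_quotient] at h1
  have h2 : PrimeSpectrum.zeroLocus (p.asIdeal : Set (MvPolynomial (Fin n) K)) = Set.Ici p := by
    ext q; rfl
  rw [h2, ← Order.coheight_eq_krullDim_Ici] at h1
  have h3 : ((Order.coheight p : ℕ∞) : WithBot ℕ∞) ≤ ((A.card : ℕ∞) : WithBot ℕ∞) := by
    simpa using h1
  exact WithBot.coe_le_coe.1 h3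

/-- The depth of `S/I(G)` is at most the size of any maximal independent set. -/
theorem gradedDepth_le_of_independent_dominating (K : Type*) [Field K]
    (hind : ∀ i ∈ A, ∀ j ∈ A, ¬ G.Adj i j) (hdom : ∀ j ∉ A, ∃ i ∈ A, G.Adj i j) :
    gradedDepth K n (MvPolynomial (Fin n) K ⧸ edgeIdeal K G) ≤ A.card := by
  have hN : {j | ∃ i ∈ A, G.Adj i j} = (A : Set (Fin n))ᶜ := by
    ext j
    refine ⟨?_, hdom j⟩
    rintro ⟨i, hi, hij⟩ hj
    exact hind i hi j hj hij
  let p : PrimeSpectrum (MvPolynomial (Fin n) K) :=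
    ⟨Ideal.span (X '' (A : Set (Fin n))ᶜ), isPrime_span_image_X _⟩
  have hdel : deletionIdeal G (A : Set (Fin n))ᶜ K = p.asIdeal :=
    deletionIdeal_eq_span K fun i j hij => by
      by_contra! h
      exact hind i (by simpa using h.1) j (by simpa using h.2) hij
  have hass : IsAssociatedPrime p.asIdeal (MvPolynomial (Fin n) K ⧸ edgeIdeal K G) := by
    refine isAssociatedPrime_iff.2 ⟨p.isPrime, Ideal.Quotient.mk _ (∏ i ∈ A, X i), ?_⟩
    ext f
    rw [Submodule.mem_colon_singleton, Submodule.mem_bot, ← hdel, ← hN,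
      ← prod_X_mul_mem_edgeIdeal hind, mul_comm, ← Ideal.Quotient.eq_zero_iff_mem]
    rfl
  have hm : (Ideal.span (Set.range (X : Fin n → MvPolynomial (Fin n) K))).IsPrime := by
    rw [← Set.image_univ]
    exact isPrime_span_image_X _
  refine iSup_le fun rs => ?_
  exact (length_le_coheight _ rs.1 rs.2.1 rs.2.2.1 p hass
    (Ideal.span_mono (Set.image_subset_range _ _))).trans (coheight_span_X_compl_le K p rfl)

end DepthUpperBound

/-! ### Bounds for the Stanley depth. -/

section StanleyDepth

variable {n : ℕ} {G : SimpleGraph (Fin n)} {Z : Set (Fin n)}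

/-- The exponents of the monomials in `x^b K[W]`. -/
def stanleyCell (b : Fin n →₀ ℕ) (W : Finset (Fin n)) : Set (Fin n →₀ ℕ) :=
  {a | ∃ c : Fin n →₀ ℕ, c.support ⊆ W ∧ a = c + b}

/-- The standard exponents are partitioned into finitely many cells of dimension at least `s`. -/
def HasStanleyPartition (G : SimpleGraph (Fin n)) (s : ℕ) (Z : Set (Fin n)) : Prop :=
  ∃ (r : ℕ) (b : Fin r → Fin n →₀ ℕ) (W : Fin r → Finset (Fin n)),
    (∀ i, s ≤ (W i).card) ∧ (∀ i, ∀ a ∈ stanleyCell (b i) (W i), IsStandardExponent G Z a) ∧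
    (∀ a, IsStandardExponent G Z a → ∃ i, a ∈ stanleyCell (b i) (W i)) ∧
    ∀ i j a, a ∈ stanleyCell (b i) (W i) → a ∈ stanleyCell (b j) (W j) → i = j

theorem hasStanleyPartition_of_finite {s : ℕ} {ι : Type*} [Finite ι]
    (b : ι → Fin n →₀ ℕ) (W : ι → Finset (Fin n)) (hW : ∀ i, s ≤ (W i).card)
    (hstd : ∀ i, ∀ a ∈ stanleyCell (b i) (W i), IsStandardExponent G Z a)
    (hex : ∀ a, IsStandardExponent G Z a → ∃ i, a ∈ stanleyCell (b i) (W i))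
    (huniq : ∀ i j a, a ∈ stanleyCell (b i) (W i) → a ∈ stanleyCell (b j) (W j) → i = j) :
    HasStanleyPartition G s Z := by
  obtain ⟨r, ⟨e⟩⟩ := Finite.exists_equiv_fin ι
  refine ⟨r, b ∘ e.symm, W ∘ e.symm, fun i => hW _, fun i => hstd _, fun a ha => ?_,
    fun i j a hi hj => e.symm.injective (huniq _ _ a hi hj)⟩
  obtain ⟨i, hi⟩ := hex a ha
  exact ⟨e i, by simpa using hi⟩

theorem mem_stanleyCell_add {a b : Fin n →₀ ℕ} {W : Finset (Fin n)} (e : Fin n →₀ ℕ) :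
    a ∈ stanleyCell (b + e) W ↔ ∃ a' ∈ stanleyCell b W, a = a' + e := by
  constructor
  · rintro ⟨c, hc, rfl⟩
    exact ⟨_, ⟨c, hc, rfl⟩, (add_assoc _ _ _).symm⟩
  · rintro ⟨_, ⟨c, hc, rfl⟩, rfl⟩
    exact ⟨c, hc, add_assoc _ _ _⟩

theorem isStandardExponent_insert {v : Fin n} {a : Fin n →₀ ℕ} :
    IsStandardExponent G (insert v Z) a ↔ IsStandardExponent G Z a ∧ a v = 0 := by
  simp only [IsStandardExponent, Set.forall_mem_insert]
  tauto

/-- Split by whether the exponent of x_v vanishes: the exponents with a_v > 0 are the translates by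
e_v of those for Z ∪ N(v). -/
theorem HasStanleyPartition.step {s : ℕ} {v : Fin n} (hv : v ∉ Z)
    (h1 : HasStanleyPartition G s (insert v Z))
    (h2 : HasStanleyPartition G s (Z ∪ G.neighborSet v)) : HasStanleyPartition G s Z := by
  obtain ⟨r₁, b₁, W₁, hW₁, hstd₁, hex₁, huniq₁⟩ := h1
  obtain ⟨r₂, b₂, W₂, hW₂, hstd₂, hex₂, huniq₂⟩ := h2
  have hzero : ∀ i, ∀ a ∈ stanleyCell (b₁ i) (W₁ i), a v = 0 := fun i a ha =>
    (isStandardExponent_insert.1 (hstd₁ i a ha)).2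
  have hpos : ∀ i, ∀ a ∈ stanleyCell (b₂ i + Finsupp.single v 1) (W₂ i), a v ≠ 0 := by
    intro i a ha
    obtain ⟨a', -, rfl⟩ := (mem_stanleyCell_add _).1 ha
    simp
  refine hasStanleyPartition_of_finite (ι := Fin r₁ ⊕ Fin r₂)
    (Sum.elim b₁ fun i => b₂ i + Finsupp.single v 1) (Sum.elim W₁ W₂) ?_ ?_ ?_ ?_
  · rintro (i | i)
    · exact hW₁ i
    · exact hW₂ i
  · rintro (i | i) a ha
    · exact (isStandardExponent_insert.1 (hstd₁ i a ha)).1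
    · obtain ⟨a', ha', rfl⟩ := (mem_stanleyCell_add _).1 ha
      exact (isStandardExponent_add_single hv).2 (hstd₂ i a' ha')
  · intro a ha
    by_cases hav : a v = 0
    · obtain ⟨i, hi⟩ := hex₁ a (isStandardExponent_insert.2 ⟨ha, hav⟩)
      exact ⟨Sum.inl i, hi⟩
    · obtain ⟨a', rfl⟩ : ∃ a', a = a' + Finsupp.single v 1 :=
        ⟨a - Finsupp.single v 1, (tsub_add_cancel_of_le (single_one_le_iff.2 hav)).symm⟩
      obtain ⟨i, hi⟩ := hex₂ a' ((isStandardExponent_add_single hv).1 ha)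
      exact ⟨Sum.inr i, (mem_stanleyCell_add _).2 ⟨a', hi, rfl⟩⟩
  · rintro (i | i) (j | j) a hi hj
    · exact congrArg _ (huniq₁ i j a hi hj)
    · exact absurd (hzero i a hi) (hpos j a hj)
    · exact absurd (hzero j a hj) (hpos i a hi)
    · obtain ⟨a', hi', rfl⟩ := (mem_stanleyCell_add _).1 hi
      obtain ⟨a'', hj', he⟩ := (mem_stanleyCell_add _).1 hj
      rw [← add_right_cancel he] at hj'
      exact congrArg _ (huniq₂ i j a' hi' hj')

theorem hasStanleyPartition_of_packing {s : ℕ} {c : Fin s → Fin n}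
    (hc : Pairwise fun t u => Disjoint (closedNbhd G (c t)) (closedNbhd G (c u))) :
    HasStanleyPartition G s ∅ := by
  classical
  refine packing_induction G hc (HasStanleyPartition G s) ?_ fun Z v hv h1 h2 => h1.step hv h2
  intro Z hZ hw
  choose w hw hwZ using hw
  have hinj : Function.Injective w := fun t u htu => by
    by_contra hne
    exact Set.disjoint_left.1 (hc hne) (hw t) (htu ▸ hw u)
  have hmem : ∀ i, i ∈ Zᶜ.toFinset ↔ i ∉ Z := fun i => by simp
  -- With no edge left, the single cell K[x_i : i ∉ Z] suffices; the distinct `w t` give its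
  -- dimension.
  refine hasStanleyPartition_of_finite (ι := Unit) (fun _ => 0) (fun _ => Zᶜ.toFinset)
    (fun _ => ?_) ?_ ?_ fun _ _ _ _ _ => rfl
  · calc s = (Finset.univ.image w).card := by simp [Finset.card_image_of_injective _ hinj]
      _ ≤ _ := Finset.card_le_card fun x hx => by
        obtain ⟨t, -, rfl⟩ := Finset.mem_image.1 hx
        exact (hmem _).2 (hwZ t)
  · rintro - a ⟨c, hc, rfl⟩
    have hzero : ∀ i ∈ Z, (c + 0 : Fin n →₀ ℕ) i = 0 := fun i hi => by
      by_contra h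
      exact (hmem i).1 (hc (Finsupp.mem_support_iff.2 (by simpa using h))) hi
    exact ⟨fun i j hij => (hZ i j hij).imp (hzero i) (hzero j), hzero⟩
  · intro a ha
    refine ⟨(), a, fun i hi => (hmem i).2 fun hiZ => ?_, (add_zero a).symm⟩
    exact Finsupp.mem_support_iff.1 hi (ha.2 i hiZ)

variable {K : Type*} [Field K]

theorem mem_edgeIdeal {f : MvPolynomial (Fin n) K} :
    f ∈ edgeIdeal K G ↔ ∀ a, IsStandardExponent G ∅ a → coeff a f = 0 := by
  rw [← deletionIdeal_empty, mem_deletionIdeal]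
  refine forall_congr' fun a => ?_
  rw [mem_support_iff]
  tauto

/-- The classes of the polynomials without the monomial of exponent `a`. -/
noncomputable def coeffZeroSubmodule (K : Type*) [Field K] (G : SimpleGraph (Fin n))
    (a : Fin n →₀ ℕ) : Submodule K (MvPolynomial (Fin n) K ⧸ edgeIdeal K G) :=
  (LinearMap.ker (lcoeff K a)).map (Ideal.Quotient.mkₐ K (edgeIdeal K G)).toLinearMap

theorem mk_mem_coeffZeroSubmodule {a : Fin n →₀ ℕ} (ha : IsStandardExponent G ∅ a)
    {f : MvPolynomial (Fin n) K} :
    Ideal.Quotient.mk (edgeIdeal K G) f ∈ coeffZeroSubmodule K G a ↔ coeff a f = 0 := by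
  constructor
  · rintro ⟨g, hg, hgf⟩
    have h1 : g - f ∈ edgeIdeal K G := Ideal.Quotient.eq.1 hgf
    have h2 := mem_edgeIdeal.1 h1 a ha
    have h3 : coeff a g = 0 := hg
    rw [coeff_sub, h3, zero_sub, neg_eq_zero] at h2
    exact h2
  · intro h
    exact ⟨f, h, rfl⟩

theorem eq_zero_of_forall_mem_coeffZeroSubmodule {x : MvPolynomial (Fin n) K ⧸ edgeIdeal K G}
    (hx : ∀ a, IsStandardExponent G ∅ a → x ∈ coeffZeroSubmodule K G a) : x = 0 := by
  obtain ⟨f, rfl⟩ := Ideal.Quotient.mk_surjective x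
  exact Ideal.Quotient.eq_zero_iff_mem.2
    (mem_edgeIdeal.2 fun a ha => (mk_mem_coeffZeroSubmodule ha).1 (hx a ha))

theorem weight_piSingle (b : Fin n →₀ ℕ) :
    Finsupp.weight (fun i : Fin n => (Pi.single i 1 : Fin n → ℤ)) b = fun i => (b i : ℤ) := by
  ext j
  rw [Finsupp.weight_apply, Finsupp.sum_fintype _ _ (by simp), Finset.sum_apply,
    Finset.sum_eq_single j]
  · simp
  · intro i _ hij
    simp [hij.symm]
  · simp

theorem monomial_smul_mk (a b : Fin n →₀ ℕ) :
    monomial a (1 : K) • Ideal.Quotient.mk (edgeIdeal K G) (monomial b 1) =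
      Ideal.Quotient.mk (edgeIdeal K G) (monomial (a + b) 1) := by
  rw [← one_mul (1 : K), ← monomial_mul, one_mul]
  rfl

/-- The Stanley decomposition with monomial generators given by a partition of the standard
exponents. -/
theorem le_stanleyDepth_of_hasStanleyPartition {s : ℕ} (h : HasStanleyPartition G s ∅) :
    (s : ℕ∞) ≤ stanleyDepth (quotientGrading (edgeIdeal K G)) := by
  obtain ⟨r, b, W, hW, hstd, hex, huniq⟩ := h
  let v : Fin r → MvPolynomial (Fin n) K ⧸ edgeIdeal K G :=
    fun i => Ideal.Quotient.mk _ (monomial (b i) 1)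
  -- Directness is tested one coefficient at a time: each standard exponent is seen by only one of
  -- the spaces.
  have hle : ∀ i a, IsStandardExponent G ∅ a → a ∉ stanleyCell (b i) (W i) →
      stanleySpace (K := K) (v i) (W i) ≤ coeffZeroSubmodule K G a := by
    intro i a ha hai
    refine Submodule.span_le.2 ?_
    rintro _ ⟨c, hc, rfl⟩
    rw [SetLike.mem_coe, monomial_smul_mk, mk_mem_coeffZeroSubmodule ha, coeff_monomial, if_neg]
    rintro rfl
    exact hai ⟨c, hc, rfl⟩
  let D : StanleyDecomposition (quotientGrading (edgeIdeal K G)) :=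
    { s := r
      v := v
      W := W
      homogeneous := fun i => ⟨fun j => (b i j : ℤ), monomial (b i) 1,
        isWeightedHomogeneous_monomial _ _ _ (weight_piSingle _), rfl⟩
      free := by
        intro i f hf hfv
        have hmem : f * monomial (b i) 1 ∈ edgeIdeal K G := Ideal.Quotient.eq_zero_iff_mem.1 hfv
        ext a
        rw [coeff_zero]
        by_contra ha
        have hsub : a.support ⊆ W i := fun j hj => by
          have := mem_supported.1 hf
          exact this ((mem_vars_iff_mem_support _).2 ⟨a, mem_support_iff.2 ha, hj⟩)
        refine ha ?_
        have := mem_edgeIdeal.1 hmem (a + b i) (hstd i _ ⟨a, hsub, rfl⟩)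
        rwa [coeff_mul_monomial, mul_one] at this
      isInternal := by
        refine DirectSum.isInternal_submodule_of_iSupIndep_of_iSup_eq_top ?_ ?_
        · rw [iSupIndep_def]
          intro i
          rw [Submodule.disjoint_def]
          intro x hx hx'
          refine eq_zero_of_forall_mem_coeffZeroSubmodule fun a ha => ?_
          by_cases hai : a ∈ stanleyCell (b i) (W i)
          · refine (iSup₂_le fun j hj => hle j a ha fun haj => hj ?_ : _ ≤ _) hx'
            exact huniq j i a haj hai
          · exact hle i a ha hai hx
        · rw [eq_top_iff]
          rintro x -
          obtain ⟨f, rfl⟩ := Ideal.Quotient.mk_surjective x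
          rw [f.as_sum, map_sum]
          refine Submodule.sum_mem _ fun a _ => ?_
          by_cases ha : IsStandardExponent G ∅ a
          · obtain ⟨i, c, hc, rfl⟩ := hex a ha
            refine Submodule.mem_iSup_of_mem i ?_
            have : Ideal.Quotient.mk (edgeIdeal K G) (monomial (c + b i) (coeff (c + b i) f)) =
                coeff (c + b i) f • (monomial c (1 : K) • v i) := by
              rw [monomial_smul_mk, ← mul_one (coeff (c + b i) f), ← smul_eq_mul, ← smul_monomial,
                smul_eq_mul, mul_one]
              rfl
            rw [this]
            exact Submodule.smul_mem _ _ (Submodule.subset_span ⟨c, hc, rfl⟩)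
          · rw [Ideal.Quotient.eq_zero_iff_mem.2]
            · exact Submodule.zero_mem _
            · refine mem_edgeIdeal.2 fun a' ha' => ?_
              rw [coeff_monomial, if_neg]
              rintro rfl
              exact ha ha' }
  refine le_trans ?_ (le_iSup StanleyDecomposition.sdepth D)
  exact le_iInf fun i => Nat.cast_le.2 (hW i)

/-- The Stanley depth of `S/I(G)` is at most the size of any maximal independent set. -/
theorem stanleyDepth_le_of_independent_dominating {A : Finset (Fin n)}
    (hind : ∀ i ∈ A, ∀ j ∈ A, ¬ G.Adj i j) (hdom : ∀ j ∉ A, ∃ i ∈ A, G.Adj i j) :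
    stanleyDepth (quotientGrading (edgeIdeal K G)) ≤ A.card := by
  classical
  refine iSup_le fun D => ?_
  let u : Fin n →₀ ℕ := Finsupp.equivFunOnFinite.symm fun i => if i ∈ A then 1 else 0
  have hu : ∀ i, u i = if i ∈ A then 1 else 0 := fun i => rfl
  have hustd : IsStandardExponent G ∅ u := by
    refine ⟨fun i j hij => ?_, by simp⟩
    by_contra! h
    simp only [hu, ne_eq, ite_eq_right_iff, one_ne_zero, imp_false, not_not] at h
    exact hind i h.1 j h.2 hij
  obtain ⟨i, a, haW, hai⟩ : ∃ i, ∃ a : Fin n →₀ ℕ, a.support ⊆ D.W i ∧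
      monomial a (1 : K) • D.v i ∉ coeffZeroSubmodule K G u := by
    by_contra! hcon
    have htop : (⊤ : Submodule K (MvPolynomial (Fin n) K ⧸ edgeIdeal K G)) ≤
        coeffZeroSubmodule K G u := by
      rw [← D.isInternal.submodule_iSup_eq_top]
      refine iSup_le fun i => Submodule.span_le.2 ?_
      rintro _ ⟨a, ha, rfl⟩
      exact hcon i a ha
    have := (mk_mem_coeffZeroSubmodule hustd).1
      (htop (x := Ideal.Quotient.mk _ (monomial u 1)) trivial)
    simp at this
  obtain ⟨d, g, hg, hgv⟩ := D.homogeneous i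
  have hgv' : D.v i = Ideal.Quotient.mk _ g := hgv.symm
  have hsmul : ∀ f, f • D.v i = Ideal.Quotient.mk _ (f * g) := fun f => by rw [hgv']; rfl
  -- A homogeneous representative is a scalar times one monomial, so x^a v_i is a nonzero multiple
  -- of x_A.
  have hcoeff : ∀ b b', coeff b g ≠ 0 → coeff b' g ≠ 0 → b = b' := by
    intro b b' hb hb'
    have h1 : _ = d := hg hb
    have h2 : _ = d := hg hb'
    rw [weight_piSingle] at h1 h2
    ext j
    exact_mod_cast congrFun (h1.trans h2.symm) j
  rw [hsmul, mk_mem_coeffZeroSubmodule hustd, coeff_monomial_mul'] at hai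
  obtain ⟨hau, hb⟩ : a ≤ u ∧ coeff (u - a) g ≠ 0 := by simpa using hai
  -- For j ∈ W_i outside A, domination puts x_j x_A in I(G), so x_j x^a kills v_i, against freeness.
  have hWA : D.W i ⊆ A := by
    intro j hj
    by_contra hjA
    obtain ⟨l, hl, hlj⟩ := hdom j hjA
    have hne : (monomial (a + Finsupp.single j 1) (1 : K)) • D.v i ≠ 0 := fun h0 => by
      have := D.free i _ ?_ h0
      · exact one_ne_zero (monomial_eq_zero.1 this)
      · rw [mem_supported, vars_monomial one_ne_zero]
        intro x hx
        rcases Finset.mem_union.1 (Finsupp.support_add hx) with h | h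
        · exact haW h
        · rw [Finset.mem_singleton.1 (Finsupp.support_single_subset h)]
          exact hj
    refine hne ?_
    rw [hsmul, Ideal.Quotient.eq_zero_iff_mem, mem_edgeIdeal]
    intro x hx
    rw [coeff_monomial_mul']
    split_ifs with hle
    · by_contra h
      rw [one_mul] at h
      have hxu : x = u + Finsupp.single j 1 := by
        rw [← tsub_add_cancel_of_le hle, hcoeff _ _ h hb, ← add_assoc, tsub_add_cancel_of_le hau]
      subst hxu
      have := ((isStandardExponent_add_single (Set.notMem_empty j)).1 hx).2 l (Or.inr hlj.symm)
      simp [hu, hl] at this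
    · rfl
  exact (iInf_le _ i).trans (Nat.cast_le.2 (Finset.card_le_card hWA))

end StanleyDepth

/-! ### Packings and dominating sets in path powers. -/

section PathPower

theorem pathPower_adj_iff {n k : ℕ} {i j : Fin n} :
    (pathPower n k).Adj i j ↔ i ≠ j ∧ (i : ℕ) ≤ j + k ∧ (j : ℕ) ≤ i + k := by
  simp only [pathPower, Fin.lt_def, ne_eq, Fin.ext_iff]
  omega

theorem mem_closedNbhd_pathPower {n k : ℕ} {i j : Fin n} :
    j ∈ closedNbhd (pathPower n k) i ↔ (i : ℕ) ≤ j + k ∧ (j : ℕ) ≤ i + k := by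
  rw [closedNbhd, Set.mem_insert_iff, SimpleGraph.mem_neighborSet, pathPower_adj_iff, ne_eq,
    Fin.ext_iff, Fin.ext_iff]
  omega

/-- Closed neighborhoods are intervals of radius k, so centers spaced 2k + 1 apart, starting at 0,
suffice. -/
theorem exists_packing_pathPower {n k s : ℕ} (hs : ∀ t, t < s ↔ (2 * k + 1) * t < n) :
    ∃ c : Fin s → Fin n, Pairwise fun t u =>
      Disjoint (closedNbhd (pathPower n k) (c t)) (closedNbhd (pathPower n k) (c u)) := by
  refine ⟨fun t => ⟨(2 * k + 1) * t, (hs t).1 t.2⟩, fun t u htu => ?_⟩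
  refine Set.disjoint_left.2 fun x hx hx' => ?_
  rw [mem_closedNbhd_pathPower] at hx hx'
  simp only at hx hx'
  rcases lt_or_gt_of_ne (Fin.val_ne_of_ne htu) with h | h
  · have := Nat.mul_le_mul_left (2 * k + 1) (Nat.succ_le_of_lt h)
    rw [Nat.succ_eq_add_one, mul_add, mul_one] at this
    omega
  · have := Nat.mul_le_mul_left (2 * k + 1) (Nat.succ_le_of_lt h)
    rw [Nat.succ_eq_add_one, mul_add, mul_one] at this
    omega

theorem exists_independent_dominating_pathPower {n k s : ℕ}
    (hs : ∀ t, t < s ↔ (2 * k + 1) * t < n) :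
    ∃ A : Finset (Fin n), A.card ≤ s ∧ (∀ i ∈ A, ∀ j ∈ A, ¬ (pathPower n k).Adj i j) ∧
      ∀ j ∉ A, ∃ i ∈ A, (pathPower n k).Adj i j := by
  classical
  -- Midpoints of consecutive blocks of 2k + 1 vertices. The last block may be short, hence the cap
  -- at n - 1; the capped point still lies in its block, more than k beyond the previous midpoint.
  let a : Fin s → Fin n := fun t =>
    ⟨min (k + (2 * k + 1) * t) (n - 1), by have := (hs t).1 t.2; omega⟩
  have ha : ∀ t, (a t : ℕ) = min (k + (2 * k + 1) * t) (n - 1) := fun t => rfl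
  have hfar : ∀ t u : Fin s, (t : ℕ) < u → (a t : ℕ) + k < a u := by
    intro t u htu
    have h1 := Nat.mul_le_mul_left (2 * k + 1) (Nat.succ_le_of_lt htu)
    have h2 := (hs u).1 u.2
    rw [Nat.succ_eq_add_one, mul_add, mul_one] at h1
    rw [ha, ha]
    omega
  refine ⟨Finset.univ.image a, Finset.card_image_le.trans (by simp), ?_, fun j hj => ?_⟩
  · intro i hi j hj hij
    obtain ⟨t, -, rfl⟩ := Finset.mem_image.1 hi
    obtain ⟨u, -, rfl⟩ := Finset.mem_image.1 hj
    obtain ⟨hne, h1, h2⟩ := pathPower_adj_iff.1 hij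
    rcases lt_trichotomy (t : ℕ) u with h | h | h
    · have := hfar t u h
      omega
    · exact hne (by rw [Fin.ext h])
    · have := hfar u t h
      omega
  · have h1 := Nat.div_add_mod (j : ℕ) (2 * k + 1)
    have h2 := Nat.mod_lt (j : ℕ) (show 0 < 2 * k + 1 by omega)
    have h3 := j.2
    have ht : (j : ℕ) / (2 * k + 1) < s := (hs _).2 (by omega)
    have hmem : a ⟨_, ht⟩ ∈ Finset.univ.image a := Finset.mem_image_of_mem _ (Finset.mem_univ _)
    refine ⟨_, hmem, pathPower_adj_iff.2 ⟨fun h => hj (h ▸ hmem), ?_⟩⟩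
    rw [ha]
    simp only
    omega

end PathPower

theorem theorem3p13 {K : Type*} [Field K] (n k : ℕ) (hn : 2 ≤ n) (hk : 1 ≤ k) :
    stanleyDepth (quotientGrading (edgeIdeal K (pathPower n k))) =
        ((⌈(n : ℚ) / (2 * (k : ℚ) + 1)⌉₊ : ℕ) : ℕ∞) ∧
      stanleyDepth (quotientGrading (edgeIdeal K (pathPower n k))) =
        gradedDepth K n (MvPolynomial (Fin n) K ⧸ edgeIdeal K (pathPower n k)) := by
  have hs : ∀ t, t < ⌈(n : ℚ) / (2 * (k : ℚ) + 1)⌉₊ ↔ (2 * k + 1) * t < n := by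
    intro t
    rw [Nat.lt_ceil, lt_div_iff₀ (by positivity), mul_comm]
    exact_mod_cast Iff.rfl
  obtain ⟨c, hc⟩ := exists_packing_pathPower hs
  obtain ⟨A, hA, hind, hdom⟩ := exists_independent_dominating_pathPower hs
  have hsdepth := le_antisymm
    ((stanleyDepth_le_of_independent_dominating (K := K) hind hdom).trans (Nat.cast_le.2 hA))
    (le_stanleyDepth_of_hasStanleyPartition (hasStanleyPartition_of_packing hc))
  have hdepth := le_antisymm
    ((gradedDepth_le_of_independent_dominating K hind hdom).trans (Nat.cast_le.2 hA))
    (le_gradedDepth_of_packing K _ hc)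
  exact ⟨hsdepth, hsdepth.trans hdepth.symm⟩
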